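/- All Hilbert spaces are finite-dimensional and $\mathrm{S}(A)$ denotes the set of density matrices on $A$. A divergence $\mathbb{D}$ assigns to any two density matrices $\rho,\sigma$ on the same space, for all spaces, an extended real number $\mathbb{D}(\rho\|\sigma)\in[-\infty,\infty]$ (positive definiteness need not be assumed). Let $\mathrm{TPCP}(A,B)$ be the set of trace-preserving completely positive maps from $A$ to $B$. We say that $\mathbb{D}$ - is lower semicontinuous if, for every $A$, it is jointly lower semicontinuous on $\mathrm{S}(A)\times\mathrm{S}(A)$; - satisfies data processing if $\mathbb{D}(\mathcal{E}(\rho)\|\mathcal{E}(\sigma))\le\mathbb{D}(\rho\|\sigma)$ for all $A,B$, $\mathcal{E}\in\mathrm{TPCP}(A,B)$ and $\rho,\sigma\in\mathrm{S}(A)$; - is sufficient if, for all $A,B$, $\mathcal{E}\in\mathrm{TPCP}(A,B)$ and $\rho,\sigma\in\mathrm{S}(A)$, one has $\mathbb{D}(\rho\|\sigma)=\mathbb{D}(\mathcal{E}(\rho)\|\mathcal{E}(\sigma))$ if and only if there is $\mathcal{R}\in\mathrm{TPCP}(B,A)$ with $\mathcal{R}(\mathcal{E}(\rho))=\rho$ and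 $\mathcal{R}(\mathcal{E}(\sigma))=\sigma$; - has the Uhlmann property if, for all $A,B$, $\rho_{AB}\in\mathrm{S}(A\otimes B)$ and $\sigma_A\in\mathrm{S}(A)$, $$\mathbb{D}(\rho_A\|\sigma_A)=\inf\{\mathbb{D}(\rho_{AB}\|\sigma_{AB}) : \sigma_{AB}\in\mathrm{S}(A\otimes B),\ \mathrm{tr}_B\,\sigma_{AB}=\sigma_A\},\qquad \rho_A=\mathrm{tr}_B\,\rho_{AB}.$$ (If $\mathbb{D}$ is lower semicontinuous, the infimum is a minimum.) **Fact.** If a divergence $\mathbb{D}$ is lower semicontinuous, satisfies data processing and is sufficient, then it does not have the Uhlmann property. Moreover, for every $\alpha\in(\tfrac12,\infty)$ the sandwiched Rényi relative entropy $D_\alpha$ does not have the Uhlmann property. Here, for $\alpha\ne1$, $$D_\alpha(\rho\|\sigma)=\frac{1}{\alpha-1}\log\mathrm{tr}\Big[\big(\sigma^{\frac{1-\alpha}{2\alpha}}\rho\,\sigma^{\frac{1-\alpha}{2\alpha}}\big)^{\alpha}\Big]$$ if $\mathrm{supp}\,\rho\subseteq\mathrm{supp}\,\sigma$ or $\alpha<1$,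 and $+\infty$ otherwise (negative powers are taken on the support and $\log0=-\infty$), and $D_1(\rho\|\sigma)=\mathrm{tr}[\rho(\log\rho-\log\sigma)]$ if $\mathrm{supp}\,\rho\subseteq\mathrm{supp}\,\sigma$, and $+\infty$ otherwise. -/

import Mathlib

open scoped ComplexOrder

namespace QDiv

/-- The set `S(A)` of density matrices on the Hilbert space `A = ℂⁿ`: positive semidefinite matrices
of trace one.  The finite type `n` labels an orthonormal basis. -/
abbrev State (n : Type) [Fintype n] : Type :=
  {ρ : Matrix n n ℂ // ρ.PosSemidef ∧ ρ.trace = 1}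

/-- The partial trace over the second tensor factor, `tr_B : L(A ⊗ B) → L(A)`. -/
def ptrace {a b : Type} [Fintype b] (X : Matrix (a × b) (a × b) ℂ) : Matrix a a ℂ :=
  fun i j => ∑ k, X (i, k) (j, k)

/-- `ptrace` is the partial trace over the second factor: `tr_B (X ⊗ Y) = tr Y • X`. -/
theorem ptrace_kronecker {a b : Type} [Fintype b] (X : Matrix a a ℂ) (Y : Matrix b b ℂ) :
    ptrace (Matrix.kronecker X Y) = Y.trace • X := by
  ext i j
  simp [ptrace, Matrix.kronecker, Matrix.kroneckerMap_apply, Matrix.trace, ← Finset.mul_sum,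
    mul_comm]

/-- The partial trace of a density matrix is a density matrix. -/
theorem ptrace_isState {a b : Type} [Fintype a] [Fintype b] {ρ : Matrix (a × b) (a × b) ℂ}
    (h : ρ.PosSemidef ∧ ρ.trace = 1) : (ptrace ρ).PosSemidef ∧ (ptrace ρ).trace = 1 := by
  constructor
  · have h1 : ptrace ρ = ∑ k, ρ.submatrix (fun i => (i, k)) (fun i => (i, k)) := by
      ext i j
      simp [ptrace, Matrix.sum_apply]
    rw [h1]
    exact Matrix.posSemidef_sum _ fun k _ => h.1.submatrix _
  · rw [← h.2]
    simp [Matrix.trace, ptrace, Fintype.sum_prod_type]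

/-- The marginal `ρ_A = tr_B ρ_AB` of a bipartite state. -/
def State.marginal {a b : Type} [Fintype a] [Fintype b] (ρ : State (a × b)) : State a :=
  ⟨ptrace ρ.1, ptrace_isState ρ.2⟩

/-- The map `id_k ⊗ E`, which applies `E` to every `a × a` block of a `k × k` block matrix. -/
def ampliation {a b : Type} (k : ℕ) (E : Matrix a a ℂ →ₗ[ℂ] Matrix b b ℂ)
    (X : Matrix (Fin k × a) (Fin k × a) ℂ) : Matrix (Fin k × b) (Fin k × b) ℂ :=
  fun p q => E (fun i j => X (p.1, i) (q.1, j)) p.2 q.2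

/-- `TPCP(A, B)`: linear maps that are completely positive and trace preserving. -/
structure Channel (a b : Type) [Fintype a] [Fintype b] where
  toLin : Matrix a a ℂ →ₗ[ℂ] Matrix b b ℂ
  completelyPositive : ∀ (k : ℕ) (X : Matrix (Fin k × a) (Fin k × a) ℂ),
    X.PosSemidef → (ampliation k toLin X).PosSemidef
  tracePreserving : ∀ X : Matrix a a ℂ, (toLin X).trace = X.trace

/-- A channel maps density matrices to density matrices. -/
theorem Channel.isState {a b : Type} [Fintype a] [Fintype b] (E : Channel a b)
    {ρ : Matrix a a ℂ} (h : ρ.PosSemidef ∧ ρ.trace = 1) :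
    (E.toLin ρ).PosSemidef ∧ (E.toLin ρ).trace = 1 := by
  refine ⟨?_, by rw [E.tracePreserving, h.2]⟩
  have h1 := E.completelyPositive 1 (ρ.submatrix Prod.snd Prod.snd) (h.1.submatrix _)
  exact h1.submatrix (fun i => ((0 : Fin 1), i))

/-- The action of a channel on states. -/
def Channel.apply {a b : Type} [Fintype a] [Fintype b] (E : Channel a b) (ρ : State a) : State b :=
  ⟨E.toLin ρ.1, E.isState ρ.2⟩

/-- A divergence assigns an extended real number `D(ρ‖σ)` to any two density matrices `ρ, σ` on the
same finite-dimensional Hilbert space, for all such spaces.  Neither finiteness, nor symmetry, nor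
positive definiteness is imposed. -/
abbrev Divergence : Type 1 :=
  (n : Type) → [Fintype n] → [DecidableEq n] → State n → State n → EReal

namespace Divergence

/-- Joint lower semicontinuity on `S(A) × S(A)`, for every `A`. -/
def IsLowerSemicontinuous (D : Divergence) : Prop :=
  ∀ (a : Type) [Fintype a] [DecidableEq a],
    LowerSemicontinuous (fun p : State a × State a => D a p.1 p.2)

/-- The data-processing inequality. -/
def SatisfiesDPI (D : Divergence) : Prop :=
  ∀ (a b : Type) [Fintype a] [DecidableEq a] [Fintype b] [DecidableEq b]
    (E : Channel a b) (ρ σ : State a), D b (E.apply ρ) (E.apply σ) ≤ D a ρ σ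

/-- `D` is sufficient if a channel preserves the divergence of `ρ` and `σ` if and only if both
states can be recovered by one channel. -/
def IsSufficient (D : Divergence) : Prop :=
  ∀ (a b : Type) [Fintype a] [DecidableEq a] [Fintype b] [DecidableEq b]
    (E : Channel a b) (ρ σ : State a),
    D a ρ σ = D b (E.apply ρ) (E.apply σ) ↔
      ∃ R : Channel b a, R.apply (E.apply ρ) = ρ ∧ R.apply (E.apply σ) = σ

/-- `D(ρ_AB ‖ C_AB^{σ_A})`: the infimum of `D(ρ_AB‖σ_AB)` over the extensions `σ_AB` of `σ_A`. -/
noncomputable def toExtensions (D : Divergence) {a b : Type} [Fintype a] [DecidableEq a]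
    [Fintype b] [DecidableEq b] (ρ : State (a × b)) (σ : State a) : EReal :=
  ⨅ τ ∈ {τ : State (a × b) | τ.marginal = σ}, D (a × b) ρ τ

/-- The Uhlmann property: `D(ρ_A‖σ_A) = D(ρ_AB ‖ C_AB^{σ_A})` for all `ρ_AB` and `σ_A`. -/
def HasUhlmannProperty (D : Divergence) : Prop :=
  ∀ (a b : Type) [Fintype a] [DecidableEq a] [Fintype b] [DecidableEq b]
    (ρ : State (a × b)) (σ : State a), D a ρ.marginal σ = D.toExtensions ρ σ

end Divergence

section Renyi

variable {n : Type} [Fintype n] [DecidableEq n]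

/-- The real power of a Hermitian matrix by functional calculus.  As `0 ^ p = 0` for `p ≠ 0`, a
negative power of a positive semidefinite matrix is taken on its support. -/
noncomputable def mpow (X : Matrix n n ℂ) (p : ℝ) : Matrix n n ℂ := cfc (fun x : ℝ => x ^ p) X

/-- The natural logarithm of a Hermitian matrix by functional calculus, with `log 0 = 0`. -/
noncomputable def mlog (X : Matrix n n ℂ) : Matrix n n ℂ := cfc Real.log X

/-- The support of a Hermitian matrix, which is its range. -/
def supp (X : Matrix n n ℂ) : Submodule ℂ (n → ℂ) := LinearMap.range X.mulVecLin

/-- `Q_α(ρ‖σ) = tr[(σ^((1-α)/(2α)) ρ σ^((1-α)/(2α)))^α]`. -/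
noncomputable def renyiQ (α : ℝ) (ρ σ : State n) : ℝ :=
  (mpow (mpow σ.1 ((1 - α) / (2 * α)) * ρ.1 * mpow σ.1 ((1 - α) / (2 * α))) α).trace.re

open Classical in
/-- The relative entropy `D(ρ‖σ) = tr[ρ (log ρ - log σ)]` if `supp ρ ⊆ supp σ`, else `+∞`. -/
noncomputable def relEntropy (ρ σ : State n) : EReal :=
  if supp ρ.1 ≤ supp σ.1 then (((ρ.1 * (mlog ρ.1 - mlog σ.1)).trace.re : ℝ) : EReal) else ⊤

open Classical in
/-- The sandwiched Rényi relative entropy: `(α - 1)⁻¹ log Q_α(ρ‖σ)` if `supp ρ ⊆ supp σ` or `α < 1`,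
and `+∞` otherwise; `D_1` is the relative entropy.  The logarithm is extended by `log 0 = -∞`, so
that `D_α(ρ‖σ) = +∞` for `α < 1` and `Q_α(ρ‖σ) = 0`. -/
noncomputable def renyiAux (α : ℝ) (ρ σ : State n) : EReal :=
  if α = 1 then relEntropy ρ σ
  else if supp ρ.1 ≤ supp σ.1 ∨ α < 1 then
    (((α - 1)⁻¹ : ℝ) : EReal) * ENNReal.log (ENNReal.ofReal (renyiQ α ρ σ))
  else ⊤

end Renyi

/-- The sandwiched Rényi relative entropy `D_α`, as a divergence. -/
noncomputable def sandwichedRenyi (α : ℝ) : Divergence := fun _ _ _ ρ σ => renyiAux α ρ σ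

end QDiv

/-! Both claims are refuted by the two-qubit maximally entangled state `bell`, whose marginal is
`I/2`, and a diagonal qubit state with bias `ε`.

Sufficient divergences: take `ε = 1`. Compactness gives an optimal extension `τ` of `|0⟩⟨0|`. The
Uhlmann property says that the partial trace preserves the divergence of `bell` and `τ`, so some
channel sends `I/2` to `bell` and `|0⟩⟨0|` to `τ`. Since `|0⟩⟨0| ≤ 2 (I/2)`, positivity gives `τ ≤ 2
bell`. As `bell` is pure, `τ = bell`, which has the wrong marginal.

Rényi divergences: take `ε` small. On the marginals `D_α` is `(α/2) ε²` to leading order. For an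
extension `τ` with eigenvalues `l k`, on whose eigenvectors `bell` has weights `w k`, the divergence
is controlled by the average of a cost `h (l k)` with weights `w k`. Here `h` is `-log` for `α = 1`
and `(1 - x^γ)/γ` with `γ = (1-α)/α` otherwise. An average cost below `K ε²` forces an eigenvalue
near one. Its eigenvector must carry almost all of the bias `ε`, so it misses a weight of about
`ε²/4` of `bell`, and this weight falls on tiny eigenvalues, each of cost at least `4K`
(`sum_mul_cost_ge`, `exists_bell_weights`). A choice `K > α/2` is possible because the cost near `0`
exceeds `2α` exactly when `α > 1/2` (`exists_rpow_cost_ge`). -/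

namespace QDiv

open scoped Matrix
open Filter Topology

/-! ### Channels and compactness of the state space -/

/-- The partial trace over the second factor, as a channel. -/
noncomputable def ptraceChannel (a b : Type) [Fintype a] [Fintype b] : Channel (a × b) a where
  toLin :=
    { toFun := ptrace
      map_add' := fun X Y => by ext i j; simp [ptrace, Finset.sum_add_distrib]
      map_smul' := fun c X => by ext i j; simp [ptrace, Finset.mul_sum] }
  completelyPositive := fun k X hX => by
    have h : ampliation k
        { toFun := ptrace
          map_add' := fun X Y => by ext i j; simp [ptrace, Finset.sum_add_distrib]
          map_smul' := fun c X => by ext i j; simp [ptrace, Finset.mul_sum] } X =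
        ∑ l : b, X.submatrix (fun p : Fin k × a => (p.1, (p.2, l)))
          (fun p : Fin k × a => (p.1, (p.2, l))) := by
      ext p q
      simp [ampliation, ptrace, Matrix.sum_apply]
    rw [h]
    exact Matrix.posSemidef_sum _ fun l _ => hX.submatrix _
  tracePreserving := fun X => by
    simp [Matrix.trace, ptrace, Fintype.sum_prod_type]

theorem ptraceChannel_apply {a b : Type} [Fintype a] [Fintype b] (ρ : State (a × b)) :
    (ptraceChannel a b).apply ρ = ρ.marginal := rfl

/-- Channels are positive maps. -/
theorem Channel.posSemidef {a b : Type} [Fintype a] [Fintype b] (E : Channel a b)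
    {X : Matrix a a ℂ} (h : X.PosSemidef) : (E.toLin X).PosSemidef :=
  (E.completelyPositive 1 (X.submatrix Prod.snd Prod.snd) (h.submatrix _)).submatrix
    (fun i => ((0 : Fin 1), i))

theorem isClosed_setOf_posSemidef (n : Type) [Fintype n] :
    IsClosed {X : Matrix n n ℂ | X.PosSemidef} := by
  simp only [Matrix.posSemidef_iff_dotProduct_mulVec, Set.ofPred_and, Set.ofPred_forall]
  refine IsClosed.inter ?_ (isClosed_iInter fun x => ?_)
  · exact isClosed_eq (by fun_prop) continuous_id
  · exact isClosed_le continuous_const (by fun_prop)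

/-- Nonnegativity of the principal `2 × 2` minors gives `|ρ i j|² ≤ ρ i i * ρ j j`, and the diagonal
entries are at most the trace. This is the boundedness behind compactness. -/
theorem norm_apply_le_one {n : Type} [Fintype n] {ρ : Matrix n n ℂ} (h : ρ.PosSemidef)
    (ht : ρ.trace = 1) (i j : n) : ‖ρ i j‖ ≤ 1 := by
  classical
  have hd : ∀ i, 0 ≤ ρ i i := fun i => h.diag_nonneg
  have hle : ∀ i, (ρ i i).re ≤ 1 := fun i => by
    have := Finset.single_le_sum (f := fun i => (ρ i i).re)
      (fun i _ => (Complex.le_def.1 (hd i)).1) (Finset.mem_univ i)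
    have h2 : ∑ i, (ρ i i).re = 1 := by
      rw [← Complex.re_sum]
      exact congrArg Complex.re ht
    linarith
  have hre : ∀ i, ρ i i = ((ρ i i).re : ℂ) := fun i => by
    apply Complex.ext
    · exact (Complex.ofReal_re _).symm
    · exact (Complex.le_def.1 (hd i)).2.symm.trans (Complex.ofReal_im _).symm
  have h2 := (h.submatrix ![i, j]).det_nonneg
  rw [Matrix.det_fin_two] at h2
  simp only [Matrix.submatrix_apply, Matrix.cons_val_zero, Matrix.cons_val_one] at h2
  have hji : ρ j i = star (ρ i j) := (h.1.apply j i).symm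
  rw [hji, hre i, hre j, Complex.star_def, Complex.mul_conj, Complex.normSq_eq_norm_sq,
    ← Complex.ofReal_mul, ← Complex.ofReal_sub, Complex.zero_le_real] at h2
  have h3 : ‖ρ i j‖ ^ 2 ≤ (ρ i i).re * (ρ j j).re := by linarith
  have h4 : (ρ i i).re * (ρ j j).re ≤ 1 :=
    mul_le_one₀ (hle i) (Complex.le_def.1 (hd j)).1 (hle j)
  nlinarith [norm_nonneg (ρ i j)]

instance compactSpace_state (n : Type) [Fintype n] : CompactSpace (State n) := by
  suffices h : IsCompact {ρ : Matrix n n ℂ | ρ.PosSemidef ∧ ρ.trace = 1} from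
    isCompact_iff_compactSpace.1 h
  refine IsCompact.of_isClosed_subset
    (isCompact_univ_pi fun _ : n => isCompact_univ_pi fun _ : n =>
      isCompact_closedBall (0 : ℂ) 1) ?_ ?_
  · exact (isClosed_setOf_posSemidef n).inter (isClosed_eq (by fun_prop) continuous_const)
  · intro ρ h i _ j _
    simpa using norm_apply_le_one h.1 h.2 i j

theorem continuous_marginal {a b : Type} [Fintype a] [Fintype b] :
    Continuous (State.marginal : State (a × b) → State a) := by
  refine Continuous.subtype_mk ?_ _
  refine continuous_matrix fun i j => ?_
  exact continuous_finsetSum _ fun k _ => continuous_subtype_val.matrix_elem _ _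

/-- For a lower semicontinuous divergence the infimum over extensions is attained. -/
theorem Divergence.IsLowerSemicontinuous.exists_eq_toExtensions {D : Divergence}
    (hD : D.IsLowerSemicontinuous) {a b : Type} [Fintype a] [DecidableEq a] [Fintype b]
    [DecidableEq b] (ρ : State (a × b)) (σ : State a) (hne : ∃ τ : State (a × b), τ.marginal = σ) :
    ∃ τ : State (a × b), τ.marginal = σ ∧ D.toExtensions ρ σ = D (a × b) ρ τ := by
  have hc : IsCompact {τ : State (a × b) | τ.marginal = σ} :=
    (isClosed_eq continuous_marginal continuous_const).isCompact
  have hl : LowerSemicontinuous fun τ : State (a × b) => D (a × b) ρ τ :=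
    (hD (a × b)).comp (Continuous.prodMk_right ρ)
  obtain ⟨τ, hτ, hmin⟩ := LowerSemicontinuousOn.exists_isMinOn hne hc
    (hl.lowerSemicontinuousOn _)
  refine ⟨τ, hτ, le_antisymm (iInf₂_le τ hτ) (le_iInf₂ fun τ' h => hmin h)⟩

/-! ### Qubit states, and the claim for sufficient divergences -/

/-- A probability vector as a diagonal density matrix. -/
noncomputable def diagState {n : Type} [Fintype n] [DecidableEq n] (p : n → ℝ) (hp : ∀ i, 0 ≤ p i)
    (h1 : ∑ i, p i = 1) : State n :=
  ⟨Matrix.diagonal fun i => (p i : ℂ), Matrix.PosSemidef.diagonal fun i => by simpa using hp i, by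
    rw [Matrix.trace_diagonal]; exact_mod_cast h1⟩

/-- The qubit state with Bloch vector `(0, 0, ε)`. -/
noncomputable def biasedQubit (ε : ℝ) (h : |ε| ≤ 1) : State (Fin 2) :=
  diagState ![(1 + ε) / 2, (1 - ε) / 2]
    (fun i => by have := abs_le.1 h; fin_cases i <;> simp <;> linarith)
    (by simp; ring)

/-- The vector `(|00⟩ + |11⟩) / √2`. -/
noncomputable def bellVec (i : Fin 2 × Fin 2) : ℂ := if i.1 = i.2 then ((√2)⁻¹ : ℝ) else 0

theorem bellVec_dotProduct : star bellVec ⬝ᵥ bellVec = 1 := by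
  simp only [dotProduct, Fintype.sum_prod_type, Fin.sum_univ_two, bellVec, Pi.star_apply]
  simp [← Complex.ofReal_mul, ← mul_inv]
  norm_num

/-- The maximally entangled state of two qubits. -/
noncomputable def bell : State (Fin 2 × Fin 2) :=
  ⟨Matrix.vecMulVec bellVec (star bellVec), Matrix.posSemidef_vecMulVec_self_star _, by
    rw [Matrix.trace_vecMulVec, dotProduct_comm, bellVec_dotProduct]⟩

theorem bell_apply (i j : Fin 2 × Fin 2) :
    bell.1 i j = if i.1 = i.2 ∧ j.1 = j.2 then 1 / 2 else 0 := by
  by_cases hi : i.1 = i.2 <;> by_cases hj : j.1 = j.2 <;>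
    simp [bell, Matrix.vecMulVec_apply, bellVec, hi, hj, ← Complex.ofReal_mul,
      ← mul_inv]

theorem marginal_bell : bell.marginal = biasedQubit 0 (by simp) := by
  apply Subtype.ext
  ext i j
  fin_cases i <;> fin_cases j <;>
    simp [State.marginal, ptrace, bell_apply, biasedQubit, diagState]

theorem not_hasUhlmannProperty_of_isSufficient {D : Divergence} (hl : D.IsLowerSemicontinuous)
    (hs : D.IsSufficient) : ¬ D.HasUhlmannProperty := by
  intro hU
  -- Attainment of the infimum needs some extension; `|00⟩⟨00|` is one.
  have hext : ∃ τ : State (Fin 2 × Fin 2), τ.marginal = biasedQubit 1 (by simp) := by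
    refine ⟨diagState (fun i => if i = (0, 0) then 1 else 0)
      (fun i => by split_ifs <;> simp) (by simp), ?_⟩
    apply Subtype.ext
    ext i j
    fin_cases i <;> fin_cases j <;>
      simp [State.marginal, ptrace, biasedQubit, diagState]
  obtain ⟨τ, hτ, hmin⟩ := hl.exists_eq_toExtensions bell (biasedQubit 1 (by simp)) hext
  have hUτ := hU (Fin 2) (Fin 2) bell (biasedQubit 1 (by simp))
  rw [hmin, ← hτ, ← ptraceChannel_apply, ← ptraceChannel_apply] at hUτ
  obtain ⟨R, hR1, hR2⟩ := (hs _ _ (ptraceChannel (Fin 2) (Fin 2)) bell τ).1 hUτ.symm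
  rw [ptraceChannel_apply, marginal_bell] at hR1
  rw [ptraceChannel_apply, hτ] at hR2
  replace hR1 : R.toLin (biasedQubit 0 (by simp)).1 = bell.1 := congrArg Subtype.val hR1
  replace hR2 : R.toLin (biasedQubit 1 (by simp)).1 = τ.1 := congrArg Subtype.val hR2
  -- The order relation `|0⟩⟨0| ≤ 2 (I/2)`, which the recovery channel transports to `τ ≤ 2 bell`.
  have hle : ((2 : ℂ) • (biasedQubit 0 (by simp)).1 - (biasedQubit 1 (by simp)).1).PosSemidef := by
    have : (2 : ℂ) • (biasedQubit 0 (by simp)).1 - (biasedQubit 1 (by simp)).1 =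
        Matrix.diagonal ![0, 1] := by
      ext i j
      fin_cases i <;> fin_cases j <;> simp [biasedQubit, diagState]
    rw [this]
    exact Matrix.PosSemidef.diagonal fun i => by fin_cases i <;> simp
  have h2 := R.posSemidef hle
  rw [map_sub, map_smul, hR1, hR2] at h2
  have hm : ptrace τ.1 = (biasedQubit 1 (by simp)).1 := congrArg Subtype.val hτ
  have hdiag : ∀ i, 0 ≤ τ.1 i i := fun i => τ.2.1.diag_nonneg
  have hm0 : τ.1 (0, 0) (0, 0) + τ.1 (0, 1) (0, 1) = 1 := by
    simpa [ptrace, biasedQubit, diagState] using congrFun (congrFun hm 0) 0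
  have hm1 : τ.1 (1, 0) (1, 0) + τ.1 (1, 1) (1, 1) = 0 := by
    simpa [ptrace, biasedQubit, diagState] using congrFun (congrFun hm 1) 1
  -- The `(01, 01)` entry of `bell` vanishes, so `τ ≤ 2 bell` kills that of `τ`. With the marginal
  -- condition, all the weight of `τ` sits on `|00⟩`.
  have h01 : τ.1 (0, 1) (0, 1) = 0 := by
    have := h2.diag_nonneg (i := (0, 1))
    simp [bell_apply] at this
    exact le_antisymm this (hdiag _)
  have h11 : τ.1 (1, 1) (1, 1) = 0 := (add_eq_zero_iff_of_nonneg (hdiag _) (hdiag _)).1 hm1 |>.2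
  rw [h01, add_zero] at hm0
  have hd := (τ.2.1.submatrix ![((0 : Fin 2), (0 : Fin 2)), (1, 1)]).det_nonneg
  have hji : τ.1 (1, 1) (0, 0) = star (τ.1 (0, 0) (1, 1)) := (τ.2.1.1.apply _ _).symm
  rw [Matrix.det_fin_two] at hd
  simp only [Matrix.submatrix_apply, Matrix.cons_val_zero, Matrix.cons_val_one, hji, h11, hm0,
    Complex.star_def, Complex.mul_conj] at hd
  have hz : τ.1 (0, 0) (1, 1) = 0 := by
    rw [← Complex.normSq_eq_zero]
    refine le_antisymm ?_ (Complex.normSq_nonneg _)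
    have := (Complex.le_def.1 hd).1
    simpa using this
  -- On the span of `|00⟩` and `|11⟩`, `2 bell - τ` is `[[0, 1], [1, 1]]`, with determinant `-1`.
  have hd2 := (h2.submatrix ![((0 : Fin 2), (0 : Fin 2)), (1, 1)]).det_nonneg
  rw [Matrix.det_fin_two] at hd2
  simp [hji, h11, hm0, hz, bell_apply] at hd2
  have := (Complex.le_def.1 hd2).1
  norm_num at this

/-! ### Functional calculus for states and pure states -/

/-- Spectral decomposition of a state, compatible with the functional calculus: the columns of `U`
are orthonormal eigenvectors and `l` lists the eigenvalues. -/
theorem State.exists_spectral {n : Type} [Fintype n] [DecidableEq n] (τ : State n) :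
    ∃ (U : Matrix n n ℂ) (l : n → ℝ), (∀ k, 0 ≤ l k) ∧ ∑ k, l k = 1 ∧
      star U * U = 1 ∧ U * star U = 1 ∧
      ∀ h : ℝ → ℝ, cfc h τ.1 = U * Matrix.diagonal (fun k => (h (l k) : ℂ)) * star U := by
  have hτ := τ.2.1.isHermitian
  refine ⟨hτ.eigenvectorUnitary, hτ.eigenvalues, τ.2.1.eigenvalues_nonneg, ?_,
    Unitary.coe_star_mul_self _, Unitary.coe_mul_star_self _, fun h => ?_⟩
  · have := hτ.trace_eq_sum_eigenvalues
    rw [τ.2.2] at this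
    simp only [Complex.coe_algebraMap] at this
    exact_mod_cast this.symm
  · rw [hτ.cfc_eq, Matrix.IsHermitian.cfc, Unitary.conjStarAlgAut_apply]
    rfl

/-- The quadratic form of `U diag(d) U*`. -/
theorem dotProduct_conj_diagonal_mulVec {n : Type} [Fintype n] [DecidableEq n] (U : Matrix n n ℂ)
    (d : n → ℝ) (x : n → ℂ) :
    star x ⬝ᵥ ((U * Matrix.diagonal (fun k => (d k : ℂ)) * star U) *ᵥ x) =
      ((∑ k, Complex.normSq ((star U *ᵥ x) k) * d k : ℝ) : ℂ) := by
  rw [← Matrix.mulVec_mulVec, ← Matrix.mulVec_mulVec, Matrix.dotProduct_mulVec]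
  have : star x ᵥ* U = star (star U *ᵥ x) := by
    rw [Matrix.star_mulVec, Matrix.star_eq_conjTranspose, Matrix.conjTranspose_conjTranspose]
  rw [this]
  push_cast
  refine Finset.sum_congr rfl fun k _ => ?_
  rw [Matrix.mulVec_diagonal, Pi.star_apply, Complex.star_def, Complex.normSq_eq_conj_mul_self]
  ring

/-- A vector in the range of `U diag(l) U*` has no component along eigenvectors with eigenvalue
zero. -/
theorem star_mulVec_apply_eq_zero {n : Type} [Fintype n] [DecidableEq n] {U : Matrix n n ℂ}
    {l : n → ℝ} (hU : star U * U = 1) {x : n → ℂ}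
    (hx : x ∈ supp (U * Matrix.diagonal (fun k => (l k : ℂ)) * star U)) {k : n} (hk : l k = 0) :
    (star U *ᵥ x) k = 0 := by
  obtain ⟨y, rfl⟩ := hx
  rw [Matrix.mulVecLin_apply, Matrix.mulVec_mulVec, mul_assoc, ← mul_assoc (star U), hU, one_mul,
    ← Matrix.mulVec_mulVec, Matrix.mulVec_diagonal, hk]
  simp

theorem continuousOn_spectrum {n : Type} [Fintype n] [DecidableEq n] (A : Matrix n n ℂ)
    (f : ℝ → ℝ) : ContinuousOn f (spectrum ℝ A) :=
  (Matrix.finite_real_spectrum (A := A)).continuousOn f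

theorem spectrum_nonneg {n : Type} [Fintype n] [DecidableEq n] {A : Matrix n n ℂ}
    (hA : A.PosSemidef) {x : ℝ} (hx : x ∈ spectrum ℝ A) : 0 ≤ x := by
  rw [hA.isHermitian.spectrum_real_eq_range_eigenvalues] at hx
  obtain ⟨i, rfl⟩ := hx
  exact hA.eigenvalues_nonneg i

theorem mpow_isHermitian {n : Type} [Fintype n] [DecidableEq n] (A : Matrix n n ℂ) (p : ℝ) :
    (mpow A p).IsHermitian :=
  cfc_predicate (p := IsSelfAdjoint) (fun x : ℝ => x ^ p) A

/-- The condition on `p` is needed on the kernel: `0 ^ p * 0 ^ p` must equal `0 ^ (p + p)`, and `0 ^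
0 = 1`. -/
theorem mpow_mul_mpow {n : Type} [Fintype n] [DecidableEq n] {A : Matrix n n ℂ}
    (hA : A.PosSemidef) {p : ℝ} (hp : p + p ≠ 0) : mpow A p * mpow A p = mpow A (p + p) := by
  unfold mpow
  rw [← cfc_mul _ _ A (continuousOn_spectrum _ _) (continuousOn_spectrum _ _)]
  exact cfc_congr fun x hx => (Real.rpow_add' (spectrum_nonneg hA hx) hp).symm

/-- If `X² = c X`, then every eigenvalue of `X` is `0` or `c`. -/
theorem spectrum_subset_of_mul_self {n : Type} [Fintype n] [DecidableEq n] {X : Matrix n n ℂ}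
    (hX : X.IsHermitian) {c : ℝ} (h : X * X = (c : ℂ) • X) {x : ℝ} (hx : x ∈ spectrum ℝ X) :
    x = 0 ∨ x = c := by
  have hX' : IsSelfAdjoint X := hX
  have h1 : cfc (fun x : ℝ => x * x) X = cfc (fun x : ℝ => c * x) X := by
    rw [cfc_mul _ _ X, cfc_const_mul _ _ X, cfc_id' ℝ X, h]
    rfl
  have h2 := (cfc_eq_cfc_iff_eqOn (R := ℝ) (a := X) (hf := continuousOn_spectrum _ _)
    (hg := continuousOn_spectrum _ _)).1 h1 hx
  simp only [mul_eq_mul_right_iff] at h2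
  tauto

theorem vecMulVec_mul_self {n : Type} [Fintype n] (x : n → ℂ) {c : ℝ}
    (hc : star x ⬝ᵥ x = (c : ℂ)) :
    Matrix.vecMulVec x (star x) * Matrix.vecMulVec x (star x) =
      (c : ℂ) • Matrix.vecMulVec x (star x) := by
  rw [Matrix.vecMulVec_mul_vecMulVec, hc, Matrix.vecMulVec_smul]

theorem trace_mpow_vecMulVec {n : Type} [Fintype n] [DecidableEq n] (x : n → ℂ) {c α : ℝ}
    (hα : 0 < α) (hc : star x ⬝ᵥ x = (c : ℂ)) :
    (mpow (Matrix.vecMulVec x (star x)) α).trace = ((c ^ α : ℝ) : ℂ) := by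
  have hp : (Matrix.vecMulVec x (star x)).PosSemidef := Matrix.posSemidef_vecMulVec_self_star x
  have hX : IsSelfAdjoint (Matrix.vecMulVec x (star x)) := hp.isHermitian
  have hc0 : 0 ≤ c := by
    have : (0 : ℂ) ≤ star x ⬝ᵥ x := dotProduct_star_self_nonneg x
    rwa [hc, Complex.zero_le_real] at this
  have h1 : mpow (Matrix.vecMulVec x (star x)) α =
      ((c ^ (α - 1) : ℝ) : ℂ) • Matrix.vecMulVec x (star x) := by
    -- The only possible eigenvalues are `0` and `c`, where `y ^ α` agrees with the linear function
    -- `c ^ (α - 1) * y`.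
    have : cfc (fun y : ℝ => y ^ α) (Matrix.vecMulVec x (star x)) =
        cfc (fun y : ℝ => c ^ (α - 1) * y) (Matrix.vecMulVec x (star x)) := by
      refine cfc_congr fun y hy => ?_
      rcases spectrum_subset_of_mul_self hp.isHermitian (vecMulVec_mul_self x hc) hy with rfl | rfl
      · simp [Real.zero_rpow hα.ne']
      · rw [← Real.rpow_add_one' hc0 (by simpa using hα.ne')]
        simp
    rw [mpow, this, cfc_const_mul _ _ _, cfc_id' ℝ _]
    rfl
  rw [h1, Matrix.trace_smul, Matrix.trace_vecMulVec, dotProduct_comm, hc, smul_eq_mul,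
    ← Complex.ofReal_mul, ← Real.rpow_add_one' hc0 (by simpa using hα.ne')]
  simp

/-- `Q_α` of a pure state: `⟨x, σ^((1-α)/α) x⟩^α`. -/
theorem renyiQ_pure {n : Type} [Fintype n] [DecidableEq n] {α : ℝ} (hα : 0 < α) (hα1 : α ≠ 1)
    (x : n → ℂ) (ρ σ : State n) (hρ : ρ.1 = Matrix.vecMulVec x (star x)) {c : ℝ}
    (hc : star x ⬝ᵥ (mpow σ.1 ((1 - α) / α) *ᵥ x) = (c : ℂ)) : renyiQ α ρ σ = c ^ α := by
  have hs := mpow_isHermitian σ.1 ((1 - α) / (2 * α))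
  have h2 : (1 - α) / (2 * α) + (1 - α) / (2 * α) = (1 - α) / α := by
    field_simp
    ring
  have h0 : (1 - α) / α ≠ 0 := div_ne_zero (sub_ne_zero.2 hα1.symm) hα.ne'
  have h3 : mpow σ.1 ((1 - α) / (2 * α)) * ρ.1 * mpow σ.1 ((1 - α) / (2 * α)) =
      Matrix.vecMulVec (mpow σ.1 ((1 - α) / (2 * α)) *ᵥ x)
        (star (mpow σ.1 ((1 - α) / (2 * α)) *ᵥ x)) := by
    rw [hρ, Matrix.mul_vecMulVec, Matrix.vecMulVec_mul, Matrix.star_mulVec, hs.eq]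
  rw [renyiQ, h3, trace_mpow_vecMulVec _ hα (c := c), Complex.ofReal_re]
  rw [Matrix.star_mulVec, hs.eq, ← Matrix.dotProduct_mulVec, Matrix.mulVec_mulVec,
    mpow_mul_mpow σ.2.1 (by rwa [h2]), h2, hc]

/-- The eigenvalues are among `0` and `1`, and the convention `log 0 = 0` makes the logarithm vanish
at both. -/
theorem mlog_pure {n : Type} [Fintype n] [DecidableEq n] {x : n → ℂ} (hx : star x ⬝ᵥ x = 1) :
    mlog (Matrix.vecMulVec x (star x)) = 0 := by
  have hp : (Matrix.vecMulVec x (star x)).PosSemidef := Matrix.posSemidef_vecMulVec_self_star x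
  rw [mlog, ← cfc_const_zero ℝ (Matrix.vecMulVec x (star x))]
  refine cfc_congr fun y hy => ?_
  rcases spectrum_subset_of_mul_self hp.isHermitian
    (vecMulVec_mul_self x (c := 1) (by simpa using hx)) hy with rfl | rfl <;> simp

theorem trace_mul_mlog_pure {n : Type} [Fintype n] [DecidableEq n] {x : n → ℂ}
    (hx : star x ⬝ᵥ x = 1) (σ : Matrix n n ℂ) :
    (Matrix.vecMulVec x (star x) * (mlog (Matrix.vecMulVec x (star x)) - mlog σ)).trace =
      - (star x ⬝ᵥ (mlog σ *ᵥ x)) := by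
  rw [mlog_pure hx, zero_sub, mul_neg, Matrix.trace_neg, Matrix.vecMulVec_mul,
    Matrix.trace_vecMulVec, dotProduct_comm, Matrix.dotProduct_mulVec]

theorem mem_supp_pure {n : Type} [Fintype n] {x : n → ℂ} (hx : star x ⬝ᵥ x = 1) :
    x ∈ supp (Matrix.vecMulVec x (star x)) :=
  ⟨x, by simp [Matrix.vecMulVec_mulVec, hx]⟩

/-- On a finite set `f` agrees with a polynomial, and polynomials act entrywise on diagonal
matrices. The interpolation nodes include both the spectrum and the entries `d i`, so the two need
not be identified. -/
theorem cfc_diagonal {n : Type} [Fintype n] [DecidableEq n] (f : ℝ → ℝ) (d : n → ℝ) :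
    cfc f (Matrix.diagonal fun i => (d i : ℂ)) = Matrix.diagonal fun i => (f (d i) : ℂ) := by
  have hD : ∀ q : Polynomial ℝ, Polynomial.aeval (Matrix.diagonal fun i => (d i : ℂ)) q =
      Matrix.diagonal fun i => ((q.eval (d i) : ℝ) : ℂ) := fun q => by
    induction q using Polynomial.induction_on' with
    | add p q hp hq => simp [hp, hq, Matrix.diagonal_add]
    | monomial k a =>
      simp [Polynomial.aeval_monomial, Matrix.diagonal_pow, Matrix.algebraMap_eq_diagonal,
        Matrix.diagonal_mul_diagonal]
  have hH : IsSelfAdjoint (Matrix.diagonal fun i => (d i : ℂ)) := by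
    rw [isSelfAdjoint_iff, Matrix.star_eq_conjTranspose, Matrix.diagonal_conjTranspose]
    congr 1
    ext i
    simp
  have hfin := (Matrix.finite_real_spectrum (A := Matrix.diagonal fun i => (d i : ℂ)))
  set s := hfin.toFinset ∪ Finset.univ.image d with hs
  set q := Lagrange.interpolate s id f with hq
  have hqe : ∀ y ∈ s, q.eval y = f y := fun y hy =>
    Lagrange.eval_interpolate_at_node f (Set.injOn_id _) hy
  have h1 : cfc f (Matrix.diagonal fun i => (d i : ℂ)) =
      cfc (fun y => q.eval y) (Matrix.diagonal fun i => (d i : ℂ)) :=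
    cfc_congr fun y hy => (hqe y (by simp [hs, hy])).symm
  rw [h1, cfc_polynomial q _ hH, hD]
  congr 1
  ext i
  rw [hqe (d i) (by simp [hs])]

/-! ### Lower bound for all extensions, and expansion in the bias -/

/-- A weighted average of a decreasing cost `h` at a probability vector `l`, one entry of which may
be close to one, is bounded below quadratically in the bias `ε` of the average of `t`. -/
theorem sum_mul_cost_ge {N : Type} [Fintype N] {l w t : N → ℝ} {h : ℝ → ℝ} {ε K η : ℝ}
    (hl : ∀ k, 0 ≤ l k) (hl1 : ∑ k, l k = 1) (hw : ∀ k, 0 ≤ w k) (hw1 : ∑ k, w k = 1)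
    (ht1 : ∀ k, t k ≤ 1) (ht : ∀ k, t k ^ 2 / 4 ≤ 1 - w k) (hlt : ∑ k, l k * t k = ε)
    (h1 : ∀ k, w k ≠ 0 → 1 - l k ≤ h (l k)) (h2 : ∀ k, w k ≠ 0 → l k ≤ η → 4 * K ≤ h (l k))
    (hK : 0 ≤ K) (hε : 0 ≤ ε) (hKε : K * ε ≤ 1) (hη : K * ε ^ 2 ≤ η) :
    K * ε ^ 2 * (1 - K * ε) ^ 2 ≤ ∑ k, w k * h (l k) := by
  classical
  -- If no eigenvalue is close to one, `h x ≥ 1 - x` already makes every term cost at least `K ε²`.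
  by_cases hA : ∀ k, l k ≤ 1 - K * ε ^ 2
  · have h3 : ∑ k, w k * (K * ε ^ 2) ≤ ∑ k, w k * h (l k) := by
      refine Finset.sum_le_sum fun k _ => ?_
      by_cases hk : w k = 0
      · simp [hk]
      · exact mul_le_mul_of_nonneg_left (by linarith [h1 k hk, hA k]) (hw k)
    rw [← Finset.sum_mul, hw1, one_mul] at h3
    refine le_trans (mul_le_of_le_one_right (by positivity) ?_) h3
    exact pow_le_one₀ (by linarith) (by nlinarith [mul_nonneg hK hε])
  · push Not at hA
    obtain ⟨k0, hk0⟩ := hA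
    have hl0 := Finset.add_sum_erase Finset.univ l (Finset.mem_univ k0)
    have hw0 := Finset.add_sum_erase Finset.univ w (Finset.mem_univ k0)
    have hlt0 := Finset.add_sum_erase Finset.univ (fun k => l k * t k) (Finset.mem_univ k0)
    have hh0 := Finset.add_sum_erase Finset.univ (fun k => w k * h (l k)) (Finset.mem_univ k0)
    rw [hl1] at hl0
    rw [hw1] at hw0
    rw [hlt] at hlt0
    rw [← hh0]
    have hl_le : l k0 ≤ 1 := by
      linarith [Finset.sum_nonneg (s := Finset.univ.erase k0) fun k _ => hl k]
    have hrest : ∑ k ∈ Finset.univ.erase k0, l k * t k ≤ ∑ k ∈ Finset.univ.erase k0, l k :=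
      Finset.sum_le_sum fun k _ => mul_le_of_le_one_right (hl k) (ht1 k)
    -- The remaining eigenvalues sum to less than `K ε² ≤ η`, so each of weight `w k ≠ 0` costs at
    -- least `4K`.
    have hcost : (1 - w k0) * (4 * K) ≤ ∑ k ∈ Finset.univ.erase k0, w k * h (l k) := by
      rw [← hw0, add_sub_cancel_left, Finset.sum_mul]
      refine Finset.sum_le_sum fun k hk => ?_
      by_cases hk' : w k = 0
      · simp [hk']
      · refine mul_le_mul_of_nonneg_left (h2 k hk' ?_) (hw k)
        linarith [Finset.single_le_sum (fun k _ => hl k) hk]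
    have hfirst : 0 ≤ w k0 * h (l k0) := by
      by_cases hk' : w k0 = 0
      · simp [hk']
      · exact mul_nonneg (hw k0) (by linarith [h1 k0 hk'])
    -- The other eigenvectors contribute at most `K ε²` to the bias, so the dominant one supplies
    -- the rest. Combined with `t² / 4 ≤ 1 - w`, this gives the quadratic cost.
    have hε2 : ε * (1 - K * ε) ≤ l k0 * t k0 := by nlinarith
    have hsq : (ε * (1 - K * ε)) ^ 2 ≤ t k0 ^ 2 := by
      have h0 : 0 ≤ ε * (1 - K * ε) := mul_nonneg hε (by linarith)
      have h3 : (l k0 * t k0) ^ 2 ≤ t k0 ^ 2 := by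
        rw [mul_pow]
        exact mul_le_of_le_one_left (sq_nonneg _) (pow_le_one₀ (hl k0) hl_le)
      exact (pow_le_pow_left₀ h0 hε2 2).trans h3
    nlinarith [ht k0]

/-- Fidelity with a maximally entangled state in terms of the bias of the marginal populations. -/
theorem sq_sub_div_four_le {a b A B : ℝ} (hA : a ^ 2 ≤ A)
    (hB : b ^ 2 ≤ B) (hAB : A + B = 1) : (A - B) ^ 2 / 4 ≤ 1 - (a + b) ^ 2 / 2 := by
  have h1 : (a * b) ^ 2 ≤ A * B := by
    rw [mul_pow]
    exact mul_le_mul hA hB (sq_nonneg _) ((sq_nonneg a).trans hA)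
  -- As `A + B = 1`, `4AB = 1 - (A - B)²`, which is at most the square on the right.
  have h2 : (2 * (a * b)) ^ 2 ≤ (1 - (A - B) ^ 2 / 2) ^ 2 := by
    have : (A + B) ^ 2 = 1 := by rw [hAB]; norm_num
    nlinarith [sq_nonneg ((A - B) ^ 2)]
  have hAB1 : (A - B) ^ 2 ≤ 1 := by
    have : (A + B) ^ 2 = 1 := by rw [hAB]; norm_num
    nlinarith [mul_nonneg ((sq_nonneg a).trans hA) ((sq_nonneg b).trans hB)]
  have h3 := (le_abs_self _).trans (abs_le_of_sq_le_sq h2 (by linarith))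
  nlinarith [h3]

/-- The difference of the two sides vanishes to first order at `0` and has positive second
derivative there, so `0` is a local minimum with value `0`. -/
theorem eventually_mean_rpow_le {p s κ : ℝ} (hκ : s * (p * (p - 1) / 2) < κ) :
    ∀ᶠ ε in 𝓝 (0 : ℝ), s * (((1 + ε) ^ p + (1 - ε) ^ p) / 2 - 1) ≤ κ * ε ^ 2 := by
  have hd : ∀ q ε : ℝ, |ε| < 1 → HasDerivAt (fun ε : ℝ => (1 + ε) ^ q) (q * (1 + ε) ^ (q - 1)) ε :=
    fun q ε hε => by
      simpa using ((hasDerivAt_id ε).const_add 1).rpow_const (p := q)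
        (Or.inl (by have := (abs_lt.1 hε).1; simp; linarith))
  have hd' : ∀ q ε : ℝ, |ε| < 1 →
      HasDerivAt (fun ε : ℝ => (1 - ε) ^ q) (-(q * (1 - ε) ^ (q - 1))) ε := fun q ε hε => by
    simpa using ((hasDerivAt_id ε).const_sub 1).rpow_const (p := q)
        (Or.inl (by have := (abs_lt.1 hε).2; simp; linarith))
  set F : ℝ → ℝ := fun ε => κ * ε ^ 2 - s * (((1 + ε) ^ p + (1 - ε) ^ p) / 2 - 1) with hF
  set G : ℝ → ℝ := fun ε =>
    κ * (2 * ε) - s * ((p * (1 + ε) ^ (p - 1) + -(p * (1 - ε) ^ (p - 1))) / 2) with hG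
  have hFd : ∀ ε : ℝ, |ε| < 1 → HasDerivAt F (G ε) ε := fun ε hε => by
    have h1 : HasDerivAt (fun ε : ℝ => ε ^ 2) (2 * ε) ε := by simpa using hasDerivAt_pow 2 ε
    exact (h1.const_mul κ).sub
      (((((hd p ε hε).add (hd' p ε hε)).div_const 2).sub_const 1).const_mul s)
  have hGd : HasDerivAt G (κ * 2 - s * (p * (p - 1))) 0 := by
    have h1 : HasDerivAt (fun ε : ℝ => 2 * ε) 2 0 := by
      simpa using (hasDerivAt_id (0 : ℝ)).const_mul 2
    have := (h1.const_mul κ).sub ((((hd (p - 1) 0 (by simp)).const_mul p).add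
      ((hd' (p - 1) 0 (by simp)).const_mul p).neg).div_const 2 |>.const_mul s)
    refine HasDerivAt.congr_deriv this ?_
    simp only [add_zero, sub_zero, Real.one_rpow]
    ring
  have hev : deriv F =ᶠ[𝓝 0] G := by
    have : ∀ᶠ ε : ℝ in 𝓝 0, |ε| < 1 :=
      (continuous_abs.tendsto' (0 : ℝ) 0 abs_zero).eventually (gt_mem_nhds one_pos)
    exact this.mono fun ε hε => (hFd ε hε).deriv
  have hmin : IsLocalMin F 0 := by
    refine isLocalMin_of_deriv_deriv_pos ?_ ?_ (hFd 0 (by simp)).continuousAt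
    · rw [hev.deriv_eq, hGd.deriv]
      linarith
    · rw [hev.eq_of_nhds]
      simp [hG]
  refine hmin.mono fun ε hε => ?_
  simp only [hF] at hε
  norm_num at hε
  linarith

/-- The eigenvalues `l` of an extension of `biasedQubit ε`, and the weights `w` of the maximally
entangled state in the eigenbasis. -/
theorem exists_bell_weights (τ : State (Fin 2 × Fin 2)) {ε : ℝ} (hε : |ε| ≤ 1) (hε0 : 0 ≤ ε)
    (hτ : τ.marginal = biasedQubit ε hε) :
    ∃ l w : Fin 2 × Fin 2 → ℝ, (∀ k, 0 ≤ l k) ∧ (∀ k, 0 ≤ w k) ∧ ∑ k, w k = 1 ∧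
      (∀ h : ℝ → ℝ, star bellVec ⬝ᵥ (cfc h τ.1 *ᵥ bellVec) = ((∑ k, w k * h (l k) : ℝ) : ℂ)) ∧
      (supp bell.1 ≤ supp τ.1 → ∀ k, w k ≠ 0 → l k ≠ 0) ∧
      ∀ (h : ℝ → ℝ) (K η : ℝ), (∀ k, w k ≠ 0 → 1 - l k ≤ h (l k)) →
        (∀ k, w k ≠ 0 → l k ≤ η → 4 * K ≤ h (l k)) → 0 ≤ K → K * ε ≤ 1 → K * ε ^ 2 ≤ η →
        K * ε ^ 2 * (1 - K * ε) ^ 2 ≤ ∑ k, w k * h (l k) := by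
  obtain ⟨U, l, hl, hl1, hU, hU', hcfc⟩ := τ.exists_spectral
  have hτl : τ.1 = U * Matrix.diagonal (fun k => (l k : ℂ)) * star U :=
    (cfc_id' ℝ τ.1 τ.2.1.isHermitian).symm.trans (hcfc fun x => x)
  have hq : ∀ h : ℝ → ℝ, star bellVec ⬝ᵥ (cfc h τ.1 *ᵥ bellVec) =
      ((∑ k, Complex.normSq ((star U *ᵥ bellVec) k) * h (l k) : ℝ) : ℂ) := fun h => by
    rw [hcfc, dotProduct_conj_diagonal_mulVec U (fun k => h (l k))]
  have hw1 : ∑ k, Complex.normSq ((star U *ᵥ bellVec) k) = 1 := by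
    have := dotProduct_conj_diagonal_mulVec U (fun _ => 1) bellVec
    simp only [Complex.ofReal_one, Matrix.diagonal_one, mul_one, hU', Matrix.one_mulVec,
      bellVec_dotProduct] at this
    exact_mod_cast this.symm
  refine ⟨l, fun k => Complex.normSq ((star U *ᵥ bellVec) k), hl, fun k => Complex.normSq_nonneg _,
    hw1, hq, fun hs k hk hlk => hk ?_, fun h K η h1 h2 hK hKε hη => ?_⟩
  · show Complex.normSq ((star U *ᵥ bellVec) k) = 0
    rw [star_mulVec_apply_eq_zero hU (by rw [← hτl]; exact hs (mem_supp_pure bellVec_dotProduct))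
      hlk, map_zero]
  have hcol : ∀ k, ∑ i, Complex.normSq (U i k) = 1 := fun k => by
    have := congrFun (congrFun hU k) k
    simp only [Matrix.mul_apply, Matrix.star_apply, Matrix.one_apply_eq, Complex.star_def,
      ← Complex.normSq_eq_conj_mul_self] at this
    exact_mod_cast this
  have hdiag : ∀ i, τ.1 i i = ((∑ k, l k * Complex.normSq (U i k) : ℝ) : ℂ) := fun i => by
    rw [hτl, Matrix.mul_apply]
    push_cast
    refine Finset.sum_congr rfl fun k _ => ?_
    rw [Matrix.mul_diagonal, Matrix.star_apply, Complex.star_def, Complex.normSq_eq_conj_mul_self]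
    ring
  have hm : ptrace τ.1 = (biasedQubit ε hε).1 := congrArg Subtype.val hτ
  have hm0 := congrFun (congrFun hm 0) 0
  have hm1 := congrFun (congrFun hm 1) 1
  simp only [ptrace, Fin.sum_univ_two, hdiag, biasedQubit, diagState, Matrix.diagonal_apply_eq,
    Matrix.cons_val_zero, Matrix.cons_val_one] at hm0 hm1
  norm_cast at hm0 hm1
  rw [← Finset.sum_add_distrib] at hm0 hm1
  have hAB : ∀ k, (Complex.normSq (U (0, 0) k) + Complex.normSq (U (0, 1) k)) +
      (Complex.normSq (U (1, 0) k) + Complex.normSq (U (1, 1) k)) = 1 := fun k => by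
    simpa [Fintype.sum_prod_type] using hcol k
  -- Here `t k` is the bias of the first qubit in the `k`-th eigenvector; averaged with weights `l
  -- k` it is the bias `ε` of the marginal.
  refine sum_mul_cost_ge hl hl1 (fun k => Complex.normSq_nonneg _) hw1
    (t := fun k => (Complex.normSq (U (0, 0) k) + Complex.normSq (U (0, 1) k)) -
      (Complex.normSq (U (1, 0) k) + Complex.normSq (U (1, 1) k)))
    (fun k => ?_) (fun k => ?_) ?_ h1 h2 hK hε0 hKε hη
  · linarith [hAB k, Complex.normSq_nonneg (U (1, 0) k), Complex.normSq_nonneg (U (1, 1) k)]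
  · have hb := sq_sub_div_four_le (a := ‖U (0, 0) k‖) (b := ‖U (1, 1) k‖)
      (A := Complex.normSq (U (0, 0) k) + Complex.normSq (U (0, 1) k))
      (B := Complex.normSq (U (1, 0) k) + Complex.normSq (U (1, 1) k))
      (by rw [← Complex.normSq_eq_norm_sq]; linarith [Complex.normSq_nonneg (U (0, 1) k)])
      (by rw [← Complex.normSq_eq_norm_sq]; linarith [Complex.normSq_nonneg (U (1, 0) k)]) (hAB k)
    refine hb.trans (sub_le_sub_left ?_ 1)
    have hk : (star U *ᵥ bellVec) k =
        ((√2)⁻¹ : ℝ) * star (U (0, 0) k + U (1, 1) k) := by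
      simp [Matrix.mulVec, dotProduct, Fintype.sum_prod_type, bellVec, Matrix.star_apply]
      ring
    rw [hk, map_mul, Complex.normSq_ofReal, Complex.normSq_eq_norm_sq, norm_star, ← mul_inv,
      Real.mul_self_sqrt (by norm_num), ← div_eq_inv_mul]
    gcongr
    exact norm_add_le _ _
  · simp only [mul_sub, mul_add, Finset.sum_sub_distrib] at hm0 hm1 ⊢
    rw [hm0, hm1]
    ring

/-! ### Divergences of the commuting marginals -/

theorem supp_diagonal_eq_top {n : Type} [Fintype n] [DecidableEq n] {d : n → ℂ}
    (hd : ∀ i, d i ≠ 0) : supp (Matrix.diagonal d) = ⊤ := by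
  refine eq_top_iff.2 fun x _ => ⟨fun i => x i / d i, ?_⟩
  ext i
  rw [Matrix.mulVecLin_apply, Matrix.mulVec_diagonal, mul_div_cancel₀ _ (hd i)]

theorem biasedQubit_val {ε : ℝ} (hε : |ε| ≤ 1) : (biasedQubit ε hε).1 =
    Matrix.diagonal fun i => ((![(1 + ε) / 2, (1 - ε) / 2] i : ℝ) : ℂ) := rfl

theorem supp_biasedQubit {ε : ℝ} (hε : |ε| < 1) : supp (biasedQubit ε hε.le).1 = ⊤ := by
  rw [biasedQubit_val]
  refine supp_diagonal_eq_top fun i => ?_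
  have := abs_lt.1 hε
  rw [Complex.ofReal_ne_zero]
  fin_cases i
  · simp only [Fin.zero_eta, Matrix.cons_val_zero]
    linarith
  · simp only [Fin.mk_one, Matrix.cons_val_one]
    exact (by linarith : 0 < (1 - ε) / 2).ne'

theorem half_conj_rpow {x α : ℝ} (hx : 0 < x) (hα : 0 < α) :
    ((x / 2) ^ ((1 - α) / (2 * α)) * (1 / 2) * (x / 2) ^ ((1 - α) / (2 * α))) ^ α =
      x ^ (1 - α) / 2 := by
  have h1 : (x / 2) ^ ((1 - α) / (2 * α)) * (1 / 2) * (x / 2) ^ ((1 - α) / (2 * α)) =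
      (x / 2) ^ ((1 - α) / α) * (1 / 2) := by
    rw [mul_right_comm, ← Real.rpow_add (by positivity)]
    congr 2
    field_simp
    ring
  rw [h1, Real.mul_rpow (by positivity) (by norm_num), ← Real.rpow_mul (by positivity),
    div_mul_cancel₀ _ hα.ne', Real.div_rpow hx.le (by norm_num), Real.div_rpow (by norm_num)
    (by norm_num), Real.one_rpow, div_mul_div_comm, mul_one, ← Real.rpow_add (by norm_num)]
  simp

theorem renyiQ_biasedQubit {α ε : ℝ} (hα : 0 < α) (hε : |ε| < 1) :
    renyiQ α (biasedQubit 0 (by simp)) (biasedQubit ε hε.le) =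
      ((1 + ε) ^ (1 - α) + (1 - ε) ^ (1 - α)) / 2 := by
  have h := abs_lt.1 hε
  rw [renyiQ, biasedQubit_val, biasedQubit_val, mpow, mpow, cfc_diagonal,
    Matrix.diagonal_mul_diagonal, Matrix.diagonal_mul_diagonal]
  simp only [← Complex.ofReal_mul]
  rw [cfc_diagonal, Matrix.trace_diagonal, Fin.sum_univ_two, ← Complex.ofReal_add,
    Complex.ofReal_re]
  simp only [Matrix.cons_val_zero, Matrix.cons_val_one, add_zero, sub_zero]
  rw [half_conj_rpow (by linarith) hα, half_conj_rpow (by linarith) hα, add_div]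

theorem relEntropy_biasedQubit {ε : ℝ} (hε : |ε| < 1) :
    relEntropy (biasedQubit 0 (by simp)) (biasedQubit ε hε.le) =
      ((-Real.log (1 - ε ^ 2) / 2 : ℝ) : EReal) := by
  have h := abs_lt.1 hε
  rw [relEntropy, if_pos (by rw [supp_biasedQubit hε]; exact le_top), biasedQubit_val,
    biasedQubit_val, mlog, mlog, cfc_diagonal, cfc_diagonal, Matrix.diagonal_sub,
    Matrix.diagonal_mul_diagonal, Matrix.trace_diagonal, Fin.sum_univ_two]
  simp only [← Complex.ofReal_mul, ← Complex.ofReal_sub, ← Complex.ofReal_add, Complex.ofReal_re,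
    Matrix.cons_val_zero, Matrix.cons_val_one, add_zero, sub_zero]
  congr 1
  have : 1 - ε ^ 2 = (1 + ε) * (1 - ε) := by ring
  have h1 : 1 + ε ≠ 0 := by linarith
  have h2 : 1 - ε ≠ 0 := sub_ne_zero.2 h.2.ne'
  rw [this, Real.log_mul h1 h2, Real.log_div h1 (by norm_num),
    Real.log_div h2 (by norm_num), Real.log_div (by norm_num) (by norm_num),
    Real.log_one]
  ring

/-! ### The gap for the relative entropy -/

theorem not_hasUhlmannProperty_of_gap {D : Divergence} {ε : ℝ} (hε : |ε| ≤ 1) {x : EReal}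
    (h1 : D _ (biasedQubit 0 (by simp)) (biasedQubit ε hε) < x)
    (h2 : ∀ τ : State (Fin 2 × Fin 2), τ.marginal = biasedQubit ε hε → x ≤ D _ bell τ) :
    ¬ D.HasUhlmannProperty := by
  intro hU
  have := hU (Fin 2) (Fin 2) bell (biasedQubit ε hε)
  rw [marginal_bell] at this
  have hx : x ≤ D.toExtensions bell (biasedQubit ε hε) := le_iInf₂ h2
  exact absurd (hx.trans_eq this.symm) (not_le.2 h1)

theorem not_hasUhlmannProperty_relEntropy :
    ¬ (sandwichedRenyi 1).HasUhlmannProperty := by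
  have hε : |(1 / 20 : ℝ)| < 1 := by norm_num [abs_lt]
  -- With `K = 1` the bound for extensions is about `0.9 ε²`, against about `ε²/2` for the
  -- marginals. The threshold is `η = ε² = 1/400`, and `-log` is at least `4` below it.
  refine not_hasUhlmannProperty_of_gap (ε := 1 / 20) hε.le
    (x := ((1 * (1 / 20) ^ 2 * (1 - 1 * (1 / 20)) ^ 2 : ℝ) : EReal)) ?_ fun τ hτ => ?_
  · show renyiAux 1 _ _ < _
    rw [renyiAux, if_pos rfl, relEntropy_biasedQubit hε, EReal.coe_lt_coe_iff]
    have := Real.one_sub_inv_le_log_of_pos (x := 1 - (1 / 20 : ℝ) ^ 2) (by norm_num)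
    norm_num at this ⊢
    linarith
  · show _ ≤ renyiAux 1 _ _
    rw [renyiAux, if_pos rfl, relEntropy]
    split_ifs with hs
    · obtain ⟨l, w, hl, -, -, hq, hsupp, hb⟩ := exists_bell_weights τ hε.le (by norm_num) hτ
      have htr : (bell.1 * (mlog bell.1 - mlog τ.1)).trace.re = ∑ k, w k * -Real.log (l k) := by
        have h1 : (bell.1 * (mlog bell.1 - mlog τ.1)).trace =
            -(star bellVec ⬝ᵥ (mlog τ.1 *ᵥ bellVec)) := trace_mul_mlog_pure bellVec_dotProduct _
        rw [h1, mlog, hq, Complex.neg_re, Complex.ofReal_re]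
        simp
      have hpos : ∀ k, w k ≠ 0 → 0 < l k := fun k hk =>
        lt_of_le_of_ne (hl k) (hsupp hs k hk).symm
      rw [htr, EReal.coe_le_coe_iff]
      refine hb (fun x => -Real.log x) 1 (1 / 400) (fun k hk => ?_) (fun k hk hk' => ?_)
        (by norm_num) (by norm_num) (by norm_num)
      · linarith [Real.log_le_sub_one_of_pos (hpos k hk)]
      · have h4 : Real.exp 4 ≤ 400 := by
          have h5 : Real.exp 4 = Real.exp 1 ^ 4 := by rw [← Real.exp_nat_mul]; norm_num
          rw [h5]
          exact (pow_le_pow_left₀ (Real.exp_pos 1).le Real.exp_one_lt_three.le 4).trans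
            (by norm_num)
        have h6 := Real.log_le_log (hpos k hk) hk'
        have h7 := (Real.le_log_iff_exp_le (by norm_num)).2 h4
        rw [one_div, Real.log_inv] at h6
        linarith
    · exact le_top

/-! ### The gap for the other orders -/

/-- For `γ > 0` this is Bernoulli's inequality; for `γ < 0` it follows from `exp u ≥ 1 + u` and
`-log x ≥ 1 - x`. The value `0 ^ γ = 0` would make the cost negative at `x = 0` when `γ < 0`, hence
`hx0`. -/
theorem one_sub_le_rpow_cost {γ x : ℝ} (hγ : γ ≤ 1) (hγ0 : γ ≠ 0) (hx : 0 ≤ x)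
    (hx0 : γ < 0 → x ≠ 0) : 1 - x ≤ (1 - x ^ γ) / γ := by
  rcases lt_or_gt_of_ne hγ0 with h | h
  · have hx' : 0 < x := lt_of_le_of_ne hx (hx0 h).symm
    rw [le_div_iff_of_neg h, Real.rpow_def_of_pos hx']
    nlinarith [Real.add_one_le_exp (Real.log x * γ), Real.log_le_sub_one_of_pos hx']
  · rw [le_div_iff₀ h]
    have := rpow_one_add_le_one_add_mul_self (s := x - 1) (by linarith) h.le hγ
    rw [add_sub_cancel] at this
    linarith

theorem rpow_cost_antitone {γ x y : ℝ} (hγ0 : γ ≠ 0) (hx : 0 ≤ x)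
    (hx0 : γ < 0 → x ≠ 0) (hxy : x ≤ y) : (1 - y ^ γ) / γ ≤ (1 - x ^ γ) / γ := by
  rcases lt_or_gt_of_ne hγ0 with h | h
  · have hx' : 0 < x := lt_of_le_of_ne hx (hx0 h).symm
    rw [div_le_div_right_of_neg h]
    linarith [Real.rpow_le_rpow_of_nonpos hx' hxy h.le]
  · rw [div_le_div_iff_of_pos_right h]
    linarith [Real.rpow_le_rpow hx hxy h.le]

/-- For `α < 1` the cost tends to `α/(1-α)` at `0`, which exceeds `2α` because `α > 1/2`, leaving
room for `K > α/2`. For `α > 1` it tends to `+∞`, so `K = α` will do. -/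
theorem exists_rpow_cost_ge {α : ℝ} (hα : 1 / 2 < α) (hα1 : α ≠ 1) :
    ∃ K η : ℝ, α / 2 < K ∧ 0 < η ∧ 4 * K ≤ (1 - η ^ ((1 - α) / α)) / ((1 - α) / α) := by
  have hα0 : 0 < α := by linarith
  rcases lt_or_gt_of_ne hα1 with h | h
  · have hγ : 0 < (1 - α) / α := div_pos (by linarith) hα0
    obtain ⟨L, hL1, hL2⟩ : ∃ L, 2 * α < L ∧ L < 1 / ((1 - α) / α) := by
      refine exists_between ?_
      rw [lt_div_iff₀ hγ, mul_div_assoc', div_lt_one hα0]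
      nlinarith
    have ht : Tendsto (fun x : ℝ => (1 - x ^ ((1 - α) / α)) / ((1 - α) / α)) (𝓝[>] 0)
        (𝓝 (1 / ((1 - α) / α))) := by
      have h0 := (Real.continuousAt_rpow_const 0 ((1 - α) / α) (Or.inr hγ.le)).tendsto
      rw [Real.zero_rpow hγ.ne'] at h0
      simpa using ((h0.mono_left nhdsWithin_le_nhds).const_sub 1).div_const ((1 - α) / α)
    obtain ⟨η, h1, h2⟩ := ((ht.eventually (lt_mem_nhds hL2)).and self_mem_nhdsWithin).exists
    exact ⟨L / 4, η, by linarith, h2, by linarith⟩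
  · have hγ : (1 - α) / α < 0 := div_neg_of_neg_of_pos (by linarith) hα0
    obtain ⟨η, h1, h2⟩ := (((tendsto_rpow_neg_nhdsGT_zero hγ).eventually
      (eventually_ge_atTop (1 - 4 * α * ((1 - α) / α)))).and self_mem_nhdsWithin).exists
    refine ⟨α, η, by linarith, h2, ?_⟩
    rw [le_div_iff_of_neg hγ]
    linarith

theorem renyiAux_of_pos {n : Type} [Fintype n] [DecidableEq n] {α : ℝ} (hα1 : α ≠ 1)
    {ρ σ : State n} (h : supp ρ.1 ≤ supp σ.1 ∨ α < 1) (hQ : 0 < renyiQ α ρ σ) :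
    renyiAux α ρ σ = (((α - 1)⁻¹ * Real.log (renyiQ α ρ σ) : ℝ) : EReal) := by
  rw [renyiAux, if_neg hα1, if_pos h, ENNReal.log_ofReal_of_pos hQ, EReal.coe_mul]

theorem inv_mul_log_lt_of_div_lt {a x y : ℝ} (ha : a ≠ 0) (hx : 0 < x) (hy : 0 < y)
    (h : x / a < y / a) : a⁻¹ * Real.log x < a⁻¹ * Real.log y := by
  rcases lt_or_gt_of_ne ha with h0 | h0
  · rw [div_lt_div_right_of_neg h0] at h
    exact mul_lt_mul_of_neg_left (Real.log_lt_log hy h) (inv_lt_zero.2 h0)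
  · rw [div_lt_div_iff_of_pos_right h0] at h
    exact mul_lt_mul_of_pos_left (Real.log_lt_log hx h) (inv_pos.2 h0)

theorem not_hasUhlmannProperty_renyi {α : ℝ} (hα : 1 / 2 < α) (hα1 : α ≠ 1) :
    ¬ (sandwichedRenyi α).HasUhlmannProperty := by
  have hα0 : 0 < α := by linarith
  have ha : α - 1 ≠ 0 := sub_ne_zero.2 hα1
  have hγ0 : (1 - α) / α ≠ 0 := div_ne_zero (sub_ne_zero.2 hα1.symm) hα0.ne'
  have hγ1 : (1 - α) / α ≤ 1 := by rw [div_le_one hα0]; linarith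
  obtain ⟨K, η, hK, hη, hKη⟩ := exists_rpow_cost_ge hα hα1
  have hK0 : 0 < K := by linarith
  obtain ⟨β, hβ, hβK⟩ := exists_between hK
  -- the bias `ε` is chosen small enough for all quadratic approximations
  obtain ⟨ε, hmean, h1, h2, h3, h4, hε⟩ : ∃ ε : ℝ,
      (α - 1)⁻¹ * (((1 + ε) ^ (1 - α) + (1 - ε) ^ (1 - α)) / 2 - 1) ≤ β * ε ^ 2 ∧
      β < K * (1 - K * ε) ^ 2 ∧ K * ε < 1 ∧ K * ε ^ 2 < η ∧ ε < 1 / 2 ∧ 0 < ε := by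
    have e0 : ∀ᶠ ε in 𝓝 (0 : ℝ),
        (α - 1)⁻¹ * (((1 + ε) ^ (1 - α) + (1 - ε) ^ (1 - α)) / 2 - 1) ≤ β * ε ^ 2 := by
      -- With `p = 1 - α` and `s = (α - 1)⁻¹` the second-order coefficient is `α/2`, which is below
      -- `β`.
      refine eventually_mean_rpow_le (lt_of_eq_of_lt ?_ hβ)
      field_simp
      ring
    have e1 : ∀ᶠ ε in 𝓝 (0 : ℝ), β < K * (1 - K * ε) ^ 2 :=
      (Continuous.tendsto' (by fun_prop) (0 : ℝ) K (by simp)).eventually (lt_mem_nhds hβK)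
    have e2 : ∀ᶠ ε in 𝓝 (0 : ℝ), K * ε < 1 :=
      (Continuous.tendsto' (by fun_prop) (0 : ℝ) 0 (by simp)).eventually (gt_mem_nhds one_pos)
    have e3 : ∀ᶠ ε in 𝓝 (0 : ℝ), K * ε ^ 2 < η :=
      (Continuous.tendsto' (by fun_prop) (0 : ℝ) 0 (by simp)).eventually (gt_mem_nhds hη)
    have e4 : ∀ᶠ ε in 𝓝 (0 : ℝ), ε < 1 / 2 := gt_mem_nhds (by norm_num)
    have e5 : ∀ᶠ ε in 𝓝[>] (0 : ℝ), 0 < ε := self_mem_nhdsWithin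
    exact ((((e0.and (e1.and (e2.and (e3.and e4)))).filter_mono nhdsWithin_le_nhds).and
      e5).exists).imp fun ε h =>
        ⟨h.1.1, h.1.2.1, h.1.2.2.1, h.1.2.2.2.1, h.1.2.2.2.2, h.2⟩
  have hε1 : |ε| < 1 := by rw [abs_of_pos hε]; linarith
  set κ := K * ε ^ 2 * (1 - K * ε) ^ 2 with hκ
  have hκβ : β * ε ^ 2 < κ := by
    have := mul_lt_mul_of_pos_right h1 (pow_pos hε 2)
    rw [hκ]
    linarith
  have hκ0 : 0 ≤ κ := by positivity
  have hκ1 : κ ≤ 1 / 2 := by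
    have h5 : K * ε ^ 2 ≤ 1 / 2 := by nlinarith
    refine (mul_le_of_le_one_right (by positivity) ?_).trans h5
    exact pow_le_one₀ (by linarith) (by linarith [mul_pos hK0 hε])
  -- For `α < 1` positivity uses `κ ≤ 1/2`.
  have hy : 0 < 1 + (α - 1) * κ := by nlinarith
  refine not_hasUhlmannProperty_of_gap hε1.le
    (x := (((α - 1)⁻¹ * Real.log (1 + (α - 1) * κ) : ℝ) : EReal)) ?_ fun τ hτ => ?_
  · show renyiAux α _ _ < _
    have hQ := renyiQ_biasedQubit (α := α) hα0 hε1
    have hQ0 : 0 < ((1 + ε) ^ (1 - α) + (1 - ε) ^ (1 - α)) / 2 := by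
      have := Real.rpow_pos_of_pos (show 0 < 1 + ε by linarith) (1 - α)
      have := Real.rpow_pos_of_pos (show 0 < 1 - ε by linarith) (1 - α)
      linarith
    rw [renyiAux_of_pos hα1 (Or.inl (by rw [supp_biasedQubit hε1]; exact le_top))
      (by rwa [hQ]), hQ, EReal.coe_lt_coe_iff]
    refine inv_mul_log_lt_of_div_lt ha hQ0 hy ?_
    have h6 := hmean.trans_lt hκβ
    rw [mul_sub, mul_one, inv_mul_eq_div] at h6
    rw [add_div 1, mul_div_cancel_left₀ _ ha, one_div]
    linarith
  · show _ ≤ renyiAux α _ _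
    by_cases hs : supp bell.1 ≤ supp τ.1 ∨ α < 1
    swap
    · rw [renyiAux, if_neg hα1, if_neg hs]
      exact le_top
    obtain ⟨l, w, hl, hw, hw1, hq, hsupp, hb⟩ := exists_bell_weights τ hε1.le hε.le hτ
    have hQ := renyiQ_pure hα0 hα1 bellVec bell τ rfl (hq fun x => x ^ ((1 - α) / α))
    set c := ∑ k, w k * l k ^ ((1 - α) / α) with hc
    have hc0 : 0 ≤ c := Finset.sum_nonneg fun k _ => mul_nonneg (hw k) (Real.rpow_nonneg (hl k) _)
    -- Negative `γ` means `α > 1`, where a finite divergence requires the support condition.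
    have hl0 : ∀ k, w k ≠ 0 → (1 - α) / α < 0 → l k ≠ 0 := fun k hk hγ => by
      refine hsupp (hs.resolve_right fun h => ?_) k hk
      exact absurd hγ (not_lt.2 (div_nonneg (by linarith) hα0.le))
    have hκH := hb (fun x => (1 - x ^ ((1 - α) / α)) / ((1 - α) / α)) K η
      (fun k hk => one_sub_le_rpow_cost hγ1 hγ0 (hl k) (hl0 k hk))
      (fun k hk hk' => hKη.trans (rpow_cost_antitone hγ0 (hl k) (hl0 k hk) hk'))
      hK0.le h2.le h3.le
    have hH : ∑ k, w k * ((1 - l k ^ ((1 - α) / α)) / ((1 - α) / α)) =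
        (1 - c) / ((1 - α) / α) := by
      simp only [mul_div_assoc']
      rw [← Finset.sum_div]
      simp only [mul_sub, mul_one, Finset.sum_sub_distrib, hw1, hc]
    rw [hH, ← hκ] at hκH
    -- Bernoulli's inequality turns the bound on `c` into a bound on `c ^ α`
    have hdiv : α * (1 - c) / (1 - α) = (1 - c) / ((1 - α) / α) := by
      rw [div_div_eq_mul_div, mul_comm]
    rw [← hdiv] at hκH
    rcases lt_or_gt_of_ne hα1 with h | h
    · rw [le_div_iff₀ (by linarith)] at hκH
      have hB := rpow_one_add_le_one_add_mul_self (s := c - 1) (by linarith) hα0.le h.le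
      rw [add_sub_cancel] at hB
      have hle : c ^ α ≤ 1 + (α - 1) * κ := by linarith
      -- If `Q_α` vanishes, the negative prefactor turns `log 0 = -∞` into `+∞`.
      rcases (Real.rpow_nonneg hc0 α).eq_or_lt with h0 | h0
      · rw [renyiAux, if_neg hα1, if_pos hs, hQ, ← h0, ENNReal.ofReal_zero, ENNReal.log_zero,
          EReal.coe_mul_bot_of_neg (inv_lt_zero.2 (by linarith))]
        exact le_top
      · rw [renyiAux_of_pos hα1 hs (by rwa [hQ]), hQ, EReal.coe_le_coe_iff]
        exact mul_le_mul_of_nonpos_left (Real.log_le_log h0 hle) (inv_nonpos.2 (by linarith))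
    · rw [le_div_iff_of_neg (by linarith)] at hκH
      have hB := one_add_mul_self_le_rpow_one_add (s := c - 1) (by linarith) h.le
      rw [add_sub_cancel] at hB
      have hle : 1 + (α - 1) * κ ≤ c ^ α := by linarith
      rw [renyiAux_of_pos hα1 hs (by rw [hQ]; exact hy.trans_le hle), hQ, EReal.coe_le_coe_iff]
      exact mul_le_mul_of_nonneg_left (Real.log_le_log hy hle) (inv_nonneg.2 (by linarith))

end QDiv

theorem fact1 :
    (∀ D : QDiv.Divergence, D.IsLowerSemicontinuous → D.SatisfiesDPI → D.IsSufficient →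
      ¬ D.HasUhlmannProperty) ∧
    (∀ α : ℝ, 1 / 2 < α → ¬ (QDiv.sandwichedRenyi α).HasUhlmannProperty) := by
  refine ⟨fun D hl _ hs => QDiv.not_hasUhlmannProperty_of_isSufficient hl hs, fun α hα => ?_⟩
  by_cases hα1 : α = 1
  · exact hα1 ▸ QDiv.not_hasUhlmannProperty_relEntropy
  · exact QDiv.not_hasUhlmannProperty_renyi hα hα1
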